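/- Let $p$ be a prime number, let $X$ be a quasiprojective variety over $\mathbb{C}_p$ (a locally closed subscheme of some projective space over $\mathbb{C}_p$, not necessarily reduced or irreducible), and let $\Phi : X \to X$ be a morphism over $\mathbb{C}_p$. Write $\Phi^n$ for the $n$-th iterate of $\Phi$ ($\Phi^0$ is the identity) and, for any self-morphism $\Psi$ of $X$ and $x \in X(\mathbb{C}_p)$, write $\mathcal{O}_\Psi(x) = \{\Psi^n(x) : n \ge 0\}$. Let $\alpha \in X(\mathbb{C}_p)$ and let $V$ be a (Zariski) closed subvariety of $X$. Suppose that the closure of $\mathcal{O}_\Phi(\alpha)$ in $X(\mathbb{C}_p)$, for the $p$-adic topology, contains a point $\beta$ such that, for some integer $M \ge 1$: * $\Phi^M(\beta) = \beta$ (that is, $\beta$ is $\Phi$-periodic of period dividing $M$); * $\beta$ and all its iterates $\Phi^j(\beta)$ are nonsingular points of $X$; * the differential $D(\Phi^M)_\beta : T_\beta X \to T_\beta X$ is equal to $\lambda \cdot \mathrm{Id}$ for some $\lambda \in \mathbb{C}_p$ with $0 < |\lambda|_p < 1$. Then there is a finite set $S$ of pairs $(k,\ell)$ of nonnegative integers such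 that $$V(\mathbb{C}_p) \cap \mathcal{O}_\Phi(\alpha) = \bigcup_{(k,\ell) \in S} \mathcal{O}_{\Phi^k}\bigl(\Phi^\ell(\alpha)\bigr).$$ (The set $S$ may be empty, and the orbits with $k = 0$ are single points.) -/

import Mathlib

open CategoryTheory AlgebraicGeometry Topology

noncomputable section

namespace DynML

universe u

variable {K : Type u} [Field K]

/-- Schemes over a field `K`, with their `K`-morphisms. -/
abbrev SchOver (K : Type u) [Field K] := Over (Spec (CommRingCat.of K))

attribute [local instance] MvPolynomial.gradedAlgebra in
/-- Projective `n`-space over `K`: the `Proj` of `K[x₀, …, xₙ]` with its standard grading,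
together with its structure morphism to `Spec K`. -/
def projectiveSpace (K : Type u) [Field K] (n : ℕ) : SchOver K :=
  Over.mk (Proj.toSpecZero (MvPolynomial.homogeneousSubmodule (Fin (n + 1)) K) ≫
    Spec.map (CommRingCat.ofHom
      (algebraMap K (MvPolynomial.homogeneousSubmodule (Fin (n + 1)) K 0))))

/-- `X` is quasiprojective over `K`: it is `K`-isomorphic to a locally closed subscheme of some
projective space over `K`. -/
def IsQuasiProjective (X : SchOver K) : Prop :=
  ∃ (n : ℕ) (i : X ⟶ projectiveSpace K n), IsImmersion i.left

/-- `X(K)`: the `K`-rational points of `X`, i.e. the `K`-morphisms `Spec K ⟶ X`. A `K`-morphism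
`Φ : X ⟶ Y` sends `x ∈ X(K)` to `x ≫ Φ ∈ Y(K)`. -/
abbrev Pt (X : SchOver K) := Over.mk (𝟙 (Spec (CommRingCat.of K))) ⟶ X

/-- The (closed) point of the underlying topological space of `X` given by `x ∈ X(K)`. -/
def Pt.pt {X : SchOver K} (x : Pt X) : X.left :=
  x.left (IsLocalRing.closedPoint K)

/-- The iterates `Φⁿ = Φ ∘ ⋯ ∘ Φ` of a self-morphism. -/
def iter {X : SchOver K} (Φ : X ⟶ X) : ℕ → (X ⟶ X)
  | 0 => 𝟙 X
  | n + 1 => iter Φ n ≫ Φ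

/-- The orbit `{Φⁿ(α) : n ≥ 0}`. -/
def orbit {X : SchOver K} (Φ : X ⟶ X) (α : Pt X) : Set (Pt X) :=
  Set.range fun n : ℕ => α ≫ iter Φ n

/-- The points of `X(K)` that lie on a Zariski closed subset `V` of `X`, i.e. `V(K)`. -/
def closedPts {X : SchOver K} (V : TopologicalSpace.Closeds X.left) : Set (Pt X) :=
  {x | x.pt ∈ V}

/-- The local ring `𝒪_{X,x}` of `X` at `x ∈ X(K)`. -/
def LocalRing {X : SchOver K} (x : Pt X) : Type u :=
  X.left.presheaf.stalk x.pt

instance {X : SchOver K} (x : Pt X) : CommRing (LocalRing x) :=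
  inferInstanceAs (CommRing (X.left.presheaf.stalk x.pt))

/-- The germ at `x` of a regular function on an open neighbourhood of `x`. -/
def germ {X : SchOver K} (x : Pt X) (U : X.left.Opens) (hU : x.pt ∈ U) :
    Γ(X.left, U) →+* LocalRing x :=
  (X.left.presheaf.germ U x.pt hU).hom

/-- A scalar `c ∈ K` seen as a global regular function on `X`. -/
def scalar (X : SchOver K) : K →+* Γ(X.left, ⊤) :=
  ((Scheme.ΓSpecIso (CommRingCat.of K)).inv ≫ X.hom.appTop).hom

instance {X : SchOver K} (x : Pt X) : Algebra K (LocalRing x) :=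
  ((germ x ⊤ trivial).comp (scalar X)).toAlgebra

/-- The value `f(x) ∈ K` of a germ `f ∈ 𝒪_{X,x}`. -/
def value {X : SchOver K} (x : Pt X) : LocalRing x →+* K :=
  (Scheme.stalkClosedPointTo x.left).hom

/-- `K` as a module over `𝒪_{X,x}` through evaluation at `x`. -/
instance {X : SchOver K} (x : Pt X) : Module (LocalRing x) K :=
  Module.compHom K (value x)

/-- `x ∈ X(K)` is a nonsingular point of `X`. -/
def IsNonsingular {X : SchOver K} (x : Pt X) : Prop :=
  IsRegularLocalRing (LocalRing x)

/-- The tangent space of `X` at `x`: the `K`-derivations `𝒪_{X,x} → K`, where `𝒪_{X,x}` acts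
on `K` through evaluation at `x`. -/
abbrev TangentSpace {X : SchOver K} (x : Pt X) := Derivation K (LocalRing x) K

theorem value_algebraMap {X : SchOver K} (x : Pt X) (c : K) :
    value x (algebraMap K (LocalRing x) c) = c := by
  have h1 : X.left.presheaf.germ ⊤ x.pt trivial ≫ Scheme.stalkClosedPointTo x.left =
      x.left.appTop ≫ (Scheme.ΓSpecIso (CommRingCat.of K)).hom := by
    exact (Scheme.germ_stalkClosedPointTo x.left ⊤ trivial).trans (by congr 1)
  have h2 : X.hom.appTop ≫ x.left.appTop = 𝟙 _ := by
    rw [← Scheme.Hom.comp_appTop, Over.w x]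
    exact Scheme.Hom.id_appTop
  have h3 : ((Scheme.ΓSpecIso (CommRingCat.of K)).inv ≫ X.hom.appTop) ≫
      X.left.presheaf.germ ⊤ x.pt trivial ≫ Scheme.stalkClosedPointTo x.left = 𝟙 _ := by
    rw [h1, Category.assoc, reassoc_of% h2, Iso.inv_hom_id]
  exact congrArg (fun g => g.hom c) h3

theorem smul_eq_value_mul {X : SchOver K} (x : Pt X) (f : LocalRing x) (c : K) :
    f • c = value x f * c := rfl

instance {X : SchOver K} (x : Pt X) : SMulCommClass K (LocalRing x) K where
  smul_comm a f c := by
    simp only [smul_eq_value_mul, smul_eq_mul]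
    ring

/-- Pullback of germs `𝒪_{Y,y} → 𝒪_{X,x}` along `Φ : X ⟶ Y` with `Φ(x) = y`. -/
def pullback {X Y : SchOver K} (Φ : X ⟶ Y) {x : Pt X} {y : Pt Y} (h : x ≫ Φ = y) :
    LocalRing y →+* LocalRing x := by
  subst h
  exact (Φ.left.stalkMap x.pt).hom

theorem pullback_germ {X Y : SchOver K} (Φ : X ⟶ Y) {x : Pt X} {y : Pt Y} (h : x ≫ Φ = y)
    (U : Y.left.Opens) (hy : y.pt ∈ U) (hx : x.pt ∈ Φ.left ⁻¹ᵁ U) (f : Γ(Y.left, U)) :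
    pullback Φ h (germ y U hy f) = germ x (Φ.left ⁻¹ᵁ U) hx (Φ.left.app U f) := by
  subst h
  exact Scheme.Hom.germ_stalkMap_apply Φ.left U x.pt hx f

theorem pullback_algebraMap {X Y : SchOver K} (Φ : X ⟶ Y) {x : Pt X} {y : Pt Y} (h : x ≫ Φ = y)
    (c : K) : pullback Φ h (algebraMap K (LocalRing y) c) = algebraMap K (LocalRing x) c := by
  refine (pullback_germ Φ h ⊤ trivial trivial (scalar Y c)).trans ?_
  have key : scalar X = Φ.left.appTop.hom.comp (scalar Y) := by
    have e : X.hom.appTop = Y.hom.appTop ≫ Φ.left.appTop := by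
      rw [← Scheme.Hom.comp_appTop, Over.w Φ]
    unfold scalar
    rw [e]
    rfl
  change _ = germ x ⊤ trivial (scalar X c)
  rw [key]
  rfl

theorem value_pullback {X Y : SchOver K} (Φ : X ⟶ Y) {x : Pt X} {y : Pt Y} (h : x ≫ Φ = y)
    (f : LocalRing y) : value x (pullback Φ h f) = value y f := by
  subst h
  exact (congrArg (fun g => g.hom f) (Scheme.stalkClosedPointTo_comp x.left Φ.left)).symm

/-- The differential `DΦₓ : TₓX → T_yY` of `Φ : X ⟶ Y` at a point `x` with `Φ(x) = y`:
it sends a derivation `v` to `f ↦ v(f ∘ Φ)`. -/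
def differential {X Y : SchOver K} (Φ : X ⟶ Y) {x : Pt X} {y : Pt Y} (h : x ≫ Φ = y) :
    TangentSpace x →ₗ[K] TangentSpace y where
  toFun v :=
    { toFun := fun f => v (pullback Φ h f)
      map_add' := fun f g => by simp
      map_smul' := fun c f => by
        rw [Algebra.smul_def, map_mul, pullback_algebraMap, ← Algebra.smul_def, v.map_smul]
        rfl
      map_one_eq_zero' := by simp
      leibniz' := fun f g => by
        change v (pullback Φ h (f * g)) =
          value y f * v (pullback Φ h g) + value y g * v (pullback Φ h f)
        rw [map_mul, v.leibniz, smul_eq_value_mul, smul_eq_value_mul, value_pullback,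
          value_pullback] }
  map_add' v w := rfl
  map_smul' c v := rfl

/-- The topology on `X(K)` induced by the topology of `K`: the coarsest one for which `U(K)` is
open and `f : U(K) → K` is continuous, for every Zariski open `U ⊆ X` and every regular function
`f` on `U`. -/
abbrev pointTopology [TopologicalSpace K] (X : SchOver K) : TopologicalSpace (Pt X) :=
  TopologicalSpace.generateFrom
    {S | ∃ (U : X.left.Opens) (f : Γ(X.left, U)) (W : Set K), IsOpen W ∧
      S = {x | ∃ hx : x.pt ∈ U, value x (germ x U hx f) ∈ W}}

end DynML

end

/-! Let f = Φ^M, which fixes β. Its scalar differential means that f acts as λ on the cotangent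
space m/m² (`pullback_sub_smul_mem_sq`). Hence, in affine coordinates centred at β, f reads y ↦ λy +
Q(y)/S(y), with Q in the square of the ideal of the origin and S(0) ≠ 0 (`exists_rational_model`).
The formula lives in the ambient affine space and holds along X.

Such a map is linearized one orbit at a time. After a dilation all coefficients are integral, and
through each point close to the origin passes a curve γ of power series over the ring of integers
with γ(0) = 0 and f(γ(z)) = γ(λz) (`exists_linearizing_curve`). There are no small divisors: only
the numbers λ^k − 1 are inverted, and they are units because |λ| < 1. The factor gained by the
dilation makes the equation for γ a contraction.

The orbit is γ(λ^(n+1)), up to the dilation, and λ^(n+1) tends to 0. A polynomial restricted to γ is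
a power series, and a nonzero power series has finitely many zeros in such a sequence
(`finite_setOf_evalDisc_eq_zero`). So a polynomial vanishing infinitely often along the orbit
vanishes on all of it (`exists_radius_forall_orbit`).

Since β lies in the closure, some Φ^l(α) is close enough to β. Applied to the preimages of V under
Φ^j, the dichotomy shows that the return times from l on are finite or full in each class modulo M.
-/

open CategoryTheory AlgebraicGeometry Topology

noncomputable section

namespace DynML

/-! ### Power series over the ring of integers of an ultrametric field. -/

section UnitBall

open PowerSeries

variable (F : Type*) [NormedField F] [IsUltrametricDist F]

/-- The ring of integers (closed unit ball) of an ultrametric normed field. -/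
def unitBall : Subring F where
  carrier := {x | ‖x‖ ≤ 1}
  mul_mem' {a b} ha hb := by
    simpa using mul_le_one₀ (a := ‖a‖) ha (norm_nonneg b) hb
  one_mem' := by simp
  add_mem' {a b} ha hb := (IsUltrametricDist.norm_add_le_max a b).trans (max_le ha hb)
  zero_mem' := by simp
  neg_mem' {a} ha := by simpa using ha

variable {F}

theorem mem_unitBall {x : F} : x ∈ unitBall F ↔ ‖x‖ ≤ 1 := Iff.rfl

theorem unitBall_norm_le_one (x : unitBall F) : ‖x‖ ≤ 1 := x.2

theorem unitBall_norm_mul (x y : unitBall F) : ‖x * y‖ = ‖x‖ * ‖y‖ :=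
  norm_mul (x : F) y

theorem unitBall_norm_pow (x : unitBall F) (n : ℕ) : ‖x ^ n‖ = ‖x‖ ^ n :=
  norm_pow (x : F) n

theorem unitBall_dvd_of_norm_le {a b : unitBall F} (h : ‖b‖ ≤ ‖a‖) : a ∣ b := by
  rcases eq_or_ne a 0 with rfl | ha
  · have : b = 0 := by simpa using h
    simp [this]
  · have ha' : (a : F) ≠ 0 := by simpa using ha
    refine ⟨⟨(b : F) / a, ?_⟩, ?_⟩
    · rw [mem_unitBall, norm_div]
      exact div_le_one_of_le₀ h (norm_nonneg _)
    · ext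
      simp only [Subring.coe_mul]
      field_simp

theorem norm_le_of_unitBall_dvd {a b : unitBall F} (h : a ∣ b) : ‖b‖ ≤ ‖a‖ := by
  obtain ⟨c, rfl⟩ := h
  rw [unitBall_norm_mul]
  exact mul_le_of_le_one_right (norm_nonneg _) (unitBall_norm_le_one c)

/-- Otherwise 1 would be a difference of two elements of norm less than 1. -/
theorem unitBall_isUnit_pow_sub_one {a : unitBall F} (ha : ‖a‖ < 1) (k : ℕ) :
    IsUnit (a ^ (k + 1) - 1) := by
  apply isUnit_of_dvd_one
  apply unitBall_dvd_of_norm_le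
  by_contra! h
  have h1 : ‖((a ^ (k + 1) - (a ^ (k + 1) - 1) : unitBall F) : F)‖ < 1 := by
    push_cast
    rw [sub_eq_add_neg]
    refine (IsUltrametricDist.norm_add_le_max _ _).trans_lt (max_lt ?_ ?_)
    swap
    · rw [norm_neg]
      exact h.trans_le (by simp)
    rw [norm_pow]
    exact pow_lt_one₀ (norm_nonneg _) ha (by simp)
  simp at h1

theorem summable_norm_coeff_mul_pow {z : unitBall F} (hz : ‖z‖ < 1) (f : (unitBall F)⟦X⟧) :
    Summable fun n => ‖coeff n f * z ^ n‖ := by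
  refine Summable.of_nonneg_of_le (fun _ => norm_nonneg _) (fun n => ?_)
    (summable_geometric_of_lt_one (norm_nonneg z) hz)
  rw [unitBall_norm_mul, unitBall_norm_pow]
  exact mul_le_of_le_one_left (by positivity) (unitBall_norm_le_one _)

/-- Divisibility by constants plays the role of the Gauss norm: it bounds all coefficients at once.
-/
theorem C_dvd_iff {a : unitBall F} {f : (unitBall F)⟦X⟧} : C a ∣ f ↔ ∀ n, a ∣ coeff n f := by
  constructor
  · rintro ⟨g, rfl⟩ n
    simp
  · intro h
    choose g hg using h
    exact ⟨mk g, by ext1 n; simp [hg]⟩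

theorem eq_zero_of_forall_C_pow_dvd {π : unitBall F} (hπ : ‖π‖ < 1) {f : (unitBall F)⟦X⟧}
    (h : ∀ n, C (π ^ n) ∣ f) : f = 0 := by
  ext1 k
  rw [map_zero, ← norm_le_zero_iff]
  refine ge_of_tendsto' (tendsto_pow_atTop_nhds_zero_of_lt_one (norm_nonneg π) hπ) fun n => ?_
  rw [← unitBall_norm_pow]
  exact norm_le_of_unitBall_dvd (C_dvd_iff.1 (h n) k)

variable [CompleteSpace F]

instance : CompleteSpace (unitBall F) := by
  have : IsClosed (unitBall F : Set F) := isClosed_le continuous_norm continuous_const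
  exact this.completeSpace_coe

/-- Evaluation of power series with integral coefficients at a point of the open unit disc. -/
def evalDisc (z : unitBall F) (hz : ‖z‖ < 1) : (unitBall F)⟦X⟧ →+* unitBall F where
  toFun f := ∑' n, coeff n f * z ^ n
  map_one' := by
    rw [tsum_eq_single 0]
    · simp
    · intro n hn
      simp [coeff_one, hn]
  map_zero' := by simp
  map_add' f g := by
    simp only [map_add, add_mul]
    exact (summable_norm_coeff_mul_pow hz f).of_norm.tsum_add
      (summable_norm_coeff_mul_pow hz g).of_norm
  map_mul' f g := by
    rw [tsum_mul_tsum_eq_tsum_sum_antidiagonal_of_summable_norm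
      (summable_norm_coeff_mul_pow hz f) (summable_norm_coeff_mul_pow hz g)]
    refine tsum_congr fun n => ?_
    rw [coeff_mul, Finset.sum_mul]
    refine Finset.sum_congr rfl fun kl hkl => ?_
    rw [← Finset.HasAntidiagonal.mem_antidiagonal.1 hkl, pow_add]
    ring

theorem evalDisc_apply (z : unitBall F) (hz : ‖z‖ < 1) (f : (unitBall F)⟦X⟧) :
    evalDisc z hz f = ∑' n, coeff n f * z ^ n := rfl

@[simp]
theorem evalDisc_C (z : unitBall F) (hz : ‖z‖ < 1) (a : unitBall F) :
    evalDisc z hz (C a) = a := by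
  rw [evalDisc_apply, tsum_eq_single 0]
  · simp
  · intro n hn
    simp [coeff_C, hn]

@[simp]
theorem evalDisc_X (z : unitBall F) (hz : ‖z‖ < 1) : evalDisc z hz X = z := by
  rw [evalDisc_apply, tsum_eq_single 1]
  · simp
  · intro n hn
    simp [coeff_X, hn]

theorem evalDisc_rescale {z w a : unitBall F} (hz : ‖z‖ < 1) (hw : ‖w‖ < 1) (h : w = a * z)
    (f : (unitBall F)⟦X⟧) : evalDisc z hz (rescale a f) = evalDisc w hw f := by
  subst h
  simp only [evalDisc_apply, coeff_rescale, mul_pow]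
  exact tsum_congr fun n => by ring

/-- A nonzero power series over the ring of integers has only finitely many zeros in a sequence of
points tending to zero. -/
theorem finite_setOf_evalDisc_eq_zero {h : (unitBall F)⟦X⟧} (hh : h ≠ 0) (z : ℕ → unitBall F)
    (hz : ∀ n, ‖z n‖ < 1) (hz0 : ∀ n, z n ≠ 0)
    (hlim : Filter.Tendsto z Filter.atTop (𝓝 0)) :
    {n | evalDisc (z n) (hz n) h = 0}.Finite := by
  obtain ⟨d, g, hg, rfl⟩ : ∃ (d : ℕ) (g : (unitBall F)⟦X⟧), constantCoeff g ≠ 0 ∧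
      h = X ^ d * g := by
    refine ⟨h.order.toNat, divXPowOrder h, ?_, (X_pow_order_mul_divXPowOrder).symm⟩
    rwa [Ne, constantCoeff_divXPowOrder_eq_zero_iff]
  have hev : ∀ᶠ n in Filter.atTop, ‖z n‖ < ‖constantCoeff g‖ := by
    have := hlim.norm
    rw [norm_zero] at this
    exact this.eventually_lt_const (norm_pos_iff.2 hg)
  obtain ⟨N, hN⟩ := Filter.eventually_atTop.1 hev
  refine (Set.finite_lt_nat N).subset fun n hn => ?_
  by_contra hnN
  have hlt := hN n (not_lt.1 hnN)
  -- With g = g(0) + Xq, a zero z of g divides g(0), so |g(0)| ≤ |z|.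
  obtain ⟨q, hq⟩ : X ∣ g - C (constantCoeff g) := by simp [X_dvd_iff]
  have e : evalDisc (z n) (hz n) g = constantCoeff g + z n * evalDisc (z n) (hz n) q := by
    rw [eq_add_of_sub_eq hq]
    simp [add_comm]
  rw [Set.mem_ofPred_eq, map_mul, map_pow, evalDisc_X, mul_eq_zero, e] at hn
  rcases hn with hn | hn
  · exact hz0 n (eq_zero_of_pow_eq_zero hn)
  · have : z n ∣ constantCoeff g := by
      rw [eq_neg_of_add_eq_zero_left hn]
      exact (Dvd.intro _ rfl).neg_right
    exact absurd (norm_le_of_unitBall_dvd this) (not_le.2 hlt)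

/-- Power series over the ring of integers are complete for the `π`-adic topology. -/
theorem exists_adic_limit {π : unitBall F} (hπ : ‖π‖ < 1) (f : ℕ → (unitBall F)⟦X⟧)
    (hf : ∀ n, C (π ^ n) ∣ f (n + 1) - f n) : ∃ g, ∀ n, C (π ^ n) ∣ g - f n := by
  have hle : ∀ n m, n ≤ m → C (π ^ n) ∣ f m - f n := by
    intro n m hnm
    induction m, hnm using Nat.le_induction with
    | base => simp
    | succ m hm ih =>
      have h1 : C (π ^ n) ∣ f (m + 1) - f m := (map_dvd C (pow_dvd_pow π hm)).trans (hf m)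
      simpa using h1.add ih
  have hnorm : ∀ k n m, n ≤ m → ‖coeff k (f m) - coeff k (f n)‖ ≤ ‖π‖ ^ n := by
    intro k n m hnm
    rw [← map_sub, ← unitBall_norm_pow]
    exact norm_le_of_unitBall_dvd (C_dvd_iff.1 (hle n m hnm) k)
  have hlim : ∀ k, ∃ c, Filter.Tendsto (fun n => coeff k (f n)) Filter.atTop (𝓝 c) := by
    intro k
    refine cauchySeq_tendsto_of_complete (cauchySeq_of_le_geometric ‖π‖ 1 hπ fun n => ?_)
    rw [dist_comm, dist_eq_norm, one_mul]
    exact hnorm k n (n + 1) n.le_succ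
  choose c hc using hlim
  refine ⟨mk c, fun n => C_dvd_iff.2 fun k => unitBall_dvd_of_norm_le ?_⟩
  rw [map_sub, coeff_mk, unitBall_norm_pow]
  refine le_of_tendsto ((hc k).sub_const _).norm ?_
  filter_upwards [Filter.eventually_ge_atTop n] with m hm using hnorm k n m hm

/-- The contraction principle for the `π`-adic topology on tuples of power series. -/
theorem exists_fixedPoint_of_adic_contraction {ι : Type*} {π : unitBall F} (hπ : ‖π‖ < 1)
    (T : (ι → (unitBall F)⟦X⟧) → ι → (unitBall F)⟦X⟧)
    (hT : ∀ (n : ℕ) (v w : ι → (unitBall F)⟦X⟧), (∀ i, C (π ^ n) ∣ v i - w i) →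
      ∀ i, C (π ^ (n + 1)) ∣ T v i - T w i) : ∃ v, T v = v := by
  -- The Picard iterates start at 0; the case n = 0 is free because π^0 = 1.
  have hstep : ∀ n i, C (π ^ n) ∣ (T^[n + 1] 0) i - (T^[n] 0) i := by
    intro n
    induction n with
    | zero => simp
    | succ n ih =>
      rw [Function.iterate_succ_apply' T (n + 1), Function.iterate_succ_apply' T n] at *
      exact hT n _ _ ih
  choose v hv using fun i => exists_adic_limit hπ (fun n => (T^[n] 0) i) fun n => hstep n i
  refine ⟨v, funext fun i => ?_⟩
  rw [← sub_eq_zero]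
  refine eq_zero_of_forall_C_pow_dvd hπ fun n => ?_
  have h1 := hT n v (T^[n] 0) (fun i => hv i n) i
  rw [← Function.iterate_succ_apply' T n] at h1
  have h2 := h1.sub (hv i (n + 1))
  rw [sub_sub_sub_cancel_right] at h2
  exact (map_dvd C (pow_dvd_pow π n.le_succ)).trans h2

end UnitBall

/-! ### Linearization along an analytic curve. -/

theorem MvPolynomial.aeval_sub_aeval_dvd {σ R A : Type*} [CommRing R] [CommRing A] [Algebra R A]
    {a : A} {v w : σ → A} (h : ∀ i, a ∣ v i - w i) (P : MvPolynomial σ R) :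
    a ∣ MvPolynomial.aeval v P - MvPolynomial.aeval w P := by
  simp only [← Ideal.mem_span_singleton, ← Ideal.Quotient.eq] at h ⊢
  have e : ∀ v : σ → A, Ideal.Quotient.mk (Ideal.span {a}) (MvPolynomial.aeval v P) =
      MvPolynomial.aeval (fun i => Ideal.Quotient.mk (Ideal.span {a}) (v i)) P := fun v =>
    MvPolynomial.comp_aeval_apply v (Ideal.Quotient.mkₐ R (Ideal.span {a})) P
  rw [e, e]
  simp only [h]

section Linearization

open PowerSeries

variable {F : Type*} [NormedField F] [IsUltrametricDist F]

theorem rescale_C {R : Type*} [CommRing R] (a c : R) : rescale a (C c) = C c := by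
  ext1 n
  rw [coeff_rescale, coeff_C]
  split_ifs with h <;> simp [h]

theorem C_dvd_map_sub_map {a : unitBall F}
    (L : (unitBall F)⟦X⟧ →ₗ[unitBall F] (unitBall F)⟦X⟧) {q r : (unitBall F)⟦X⟧}
    (h : C a ∣ q - r) : C a ∣ L q - L r := by
  obtain ⟨s, hs⟩ := h
  exact ⟨L s, by rw [← map_sub, hs, ← smul_eq_C_mul, map_smul, smul_eq_C_mul]⟩

theorem dvd_inverse_sub_inverse {A : Type*} [CommRing A] {a u v u' v' : A} (hu : u * u' = 1)
    (hv : v * v' = 1) (h : a ∣ u - v) : a ∣ u' - v' := by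
  have : u' - v' = -(u - v) * (u' * v') := by
    linear_combination v' * hu - u' * hv
  rw [this]
  exact (h.neg_right).mul_right _

/-- Used for `constantCoeff` and for `evalDisc`, both of which fix constants. -/
theorem map_aeval_eq_eval {σ R A : Type*} [CommRing R] [CommRing A] [Algebra R A] (φ : A →+* R)
    (hφ : ∀ r, φ (algebraMap R A r) = r) (v : σ → A) (P : MvPolynomial σ R) :
    φ (MvPolynomial.aeval v P) = MvPolynomial.eval (fun i => φ (v i)) P := by
  have : φ.comp (algebraMap R A) = RingHom.id R := RingHom.ext hφ
  rw [MvPolynomial.aeval_def, MvPolynomial.hom_eval₂, this]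
  rfl

variable [CompleteSpace F]

/-- The homological equation `f(az) - f(z) = z q(z)`, `f(a) = 0` has a solution that depends
linearly on `q`. -/
theorem exists_homological_solution {a : unitBall F} (ha : ‖a‖ < 1) :
    ∃ L : (unitBall F)⟦X⟧ →ₗ[unitBall F] (unitBall F)⟦X⟧,
      ∀ q, rescale a (L q) - L q = X * q ∧ evalDisc a ha (L q) = 0 := by
  -- In degree k + 1 the equation reads (a^(k+1) − 1) f_(k+1) = q_k.
  choose b hb using fun k => (unitBall_isUnit_pow_sub_one ha k).exists_right_inv
  let L₀ : (unitBall F)⟦X⟧ →ₗ[unitBall F] (unitBall F)⟦X⟧ :=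
    { toFun := fun q => X * mk fun k => b k * coeff k q
      map_add' := fun q r => by
        rw [← mul_add]
        congr 1
        ext1 n
        simp [mul_add]
      map_smul' := fun c q => by
        rw [RingHom.id_apply, ← mul_smul_comm]
        congr 1
        ext1 n
        simp [mul_left_comm] }
  -- Constants are invariant under z ↦ az, so subtracting the value at a arranges f(a) = 0.
  let L : (unitBall F)⟦X⟧ →ₗ[unitBall F] (unitBall F)⟦X⟧ :=
    { toFun := fun q => L₀ q - C (evalDisc a ha (L₀ q))
      map_add' := fun q r => by
        simp only [map_add]
        ring
      map_smul' := fun c q => by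
        rw [L₀.map_smul, RingHom.id_apply, smul_sub, smul_eq_C_mul, smul_eq_C_mul, map_mul,
          evalDisc_C, map_mul] }
  have hL : ∀ q, L q = L₀ q - C (evalDisc a ha (L₀ q)) := fun q => rfl
  refine ⟨L, fun q => ⟨?_, ?_⟩⟩
  · rw [hL, map_sub, rescale_C, sub_sub_sub_cancel_right]
    ext1 n
    change coeff n (rescale a (X * mk fun k => b k * coeff k q) - X * mk fun k => b k * coeff k q) =
      coeff n (X * q)
    cases n with
    | zero => simp
    | succ n =>
      simp only [map_sub, coeff_rescale, coeff_succ_X_mul, coeff_mk]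
      linear_combination coeff n q * hb n
  · rw [hL, map_sub, evalDisc_C, sub_self]

/-- Existence of an analytic curve through a given point along which the map
`y ↦ a y + a² Q(y) / S(y)` with `Q` of order at least two is conjugate to multiplication by `a`. -/
theorem exists_linearizing_curve {a : unitBall F} (ha : ‖a‖ < 1) {ι : Type*} [Fintype ι]
    (S : MvPolynomial ι (unitBall F)) (hS : MvPolynomial.constantCoeff S = 1)
    (A : ι → ι → ι → MvPolynomial ι (unitBall F)) (x : ι → unitBall F) :
    ∃ γ : ι → (unitBall F)⟦X⟧, (∀ i, evalDisc a ha (γ i) = a * x i) ∧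
      ∀ i, MvPolynomial.aeval γ S * (rescale a (γ i) - C a * γ i) =
        C (a ^ 2) * ∑ j, ∑ k, MvPolynomial.aeval γ (A i j k) * (γ j * γ k) := by
  obtain ⟨L, hL⟩ := exists_homological_solution ha
  -- Put γ = Xη. It suffices that η(az) − η(z) = a z q(η) and η(a) = x, with `q` as defined below;
  -- both follow from the fixed-point equation η = x + a L(q(η)).
  let s : (ι → (unitBall F)⟦X⟧) → (unitBall F)⟦X⟧ := fun η =>
    MvPolynomial.aeval (fun i => X * η i) S
  have hs : ∀ η, s η * invOfUnit (s η) 1 = 1 := fun η => by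
    refine mul_invOfUnit _ _ ?_
    refine (map_aeval_eq_eval constantCoeff (fun r => ?_) (fun i => X * η i) S).trans ?_
    · simp
    rw [Units.val_one, ← hS, ← MvPolynomial.eval_zero]
    congr 2
    simp [funext_iff]
  let q : (ι → (unitBall F)⟦X⟧) → ι → (unitBall F)⟦X⟧ := fun η i =>
    invOfUnit (s η) 1 *
      ∑ j, ∑ k, MvPolynomial.aeval (fun i => X * η i) (A i j k) * (η j * η k)
  have hq : ∀ (n : ℕ) (v w : ι → (unitBall F)⟦X⟧), (∀ i, C (a ^ n) ∣ v i - w i) →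
      ∀ i, C (a ^ n) ∣ q v i - q w i := by
    intro n v w h i
    have hX : ∀ i, C (a ^ n) ∣ X * v i - X * w i := fun i => by
      rw [← mul_sub]
      exact (h i).mul_left _
    have h1 : C (a ^ n) ∣ invOfUnit (s v) 1 - invOfUnit (s w) 1 :=
      dvd_inverse_sub_inverse (hs v) (hs w) (MvPolynomial.aeval_sub_aeval_dvd hX S)
    have h2 : ∀ j k, C (a ^ n) ∣ MvPolynomial.aeval (fun i => X * v i) (A i j k) -
        MvPolynomial.aeval (fun i => X * w i) (A i j k) := fun j k =>
      MvPolynomial.aeval_sub_aeval_dvd hX (A i j k)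
    simp only [← Ideal.mem_span_singleton, ← Ideal.Quotient.eq] at h h1 h2 ⊢
    simp only [q, map_mul, map_sum, h, h1, h2]
  -- `q` and `L` preserve congruences modulo a^n, and the factor a in front of `L` gains one power.
  obtain ⟨η, hη⟩ := exists_fixedPoint_of_adic_contraction ha
    (fun η i => C (x i) + C a * L (q η i)) (by
      intro n v w h i
      rw [add_sub_add_left_eq_sub, ← mul_sub, pow_succ', map_mul]
      exact mul_dvd_mul_left _ (C_dvd_map_sub_map L (hq n v w h i)))
  refine ⟨fun i => X * η i, fun i => ?_, fun i => ?_⟩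
  · rw [map_mul, evalDisc_X, ← congrFun hη i, map_add, map_mul, (hL _).2, evalDisc_C]
    simp
  · have h1 : rescale a (η i) - η i = C a * (X * q η i) := by
      rw [← (hL (q η i)).1]
      nth_rewrite 1 2 [← congrFun hη i]
      simp only [map_add, map_mul, rescale_C]
      ring
    have h2 : s η * q η i =
        ∑ j, ∑ k, MvPolynomial.aeval (fun i => X * η i) (A i j k) * (η j * η k) := by
      simp only [q]
      rw [← mul_assoc, hs, one_mul]
    have h3 : ∑ j, ∑ k, MvPolynomial.aeval (fun i => X * η i) (A i j k) * (X * η j * (X * η k)) =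
        X ^ 2 * ∑ j, ∑ k, MvPolynomial.aeval (fun i => X * η i) (A i j k) * (η j * η k) := by
      simp only [Finset.mul_sum]
      exact Finset.sum_congr rfl fun j _ => Finset.sum_congr rfl fun k _ => by ring
    rw [h3, ← h2, map_mul, rescale_X, map_pow]
    change s η * _ = _
    linear_combination (s η * C a * X) * h1

end Linearization

/-! ### Orbits of a rational map near an attracting fixed point. -/

section LocalDynamics

theorem exists_eq_sum_mul_X_of_mem_idealOfVars {R σ : Type*} [CommRing R] [Fintype σ]
    {P : MvPolynomial σ R} (hP : P ∈ MvPolynomial.idealOfVars σ R) :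
    ∃ c : σ → MvPolynomial σ R, P = ∑ j, c j * MvPolynomial.X j := by
  obtain ⟨c, hc⟩ := Ideal.mem_span_range_iff_exists_fun.1 hP
  exact ⟨c, hc.symm⟩

theorem exists_eq_sum_mul_X_mul_X_of_mem_idealOfVars_sq {R σ : Type*} [CommRing R] [Fintype σ]
    {P : MvPolynomial σ R} (hP : P ∈ MvPolynomial.idealOfVars σ R ^ 2) :
    ∃ c : σ → σ → MvPolynomial σ R,
      P = ∑ j, ∑ k, c j k * (MvPolynomial.X j * MvPolynomial.X k) := by
  rw [pow_two] at hP
  induction hP using Submodule.mul_induction_on' with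
  | mem_mul_mem a ha b hb =>
    obtain ⟨c, rfl⟩ := exists_eq_sum_mul_X_of_mem_idealOfVars ha
    obtain ⟨d, rfl⟩ := exists_eq_sum_mul_X_of_mem_idealOfVars hb
    refine ⟨fun j k => c j * d k, ?_⟩
    rw [Finset.sum_mul_sum]
    exact Finset.sum_congr rfl fun j _ => Finset.sum_congr rfl fun k _ => by ring
  | add a _ b _ ha hb =>
    obtain ⟨c, rfl⟩ := ha
    obtain ⟨d, rfl⟩ := hb
    exact ⟨fun j k => c j k + d j k, by simp only [add_mul, Finset.sum_add_distrib]⟩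

variable {F : Type*} [NormedField F] [IsUltrametricDist F]

/-- Clearing denominators of a polynomial over `F` by a power of a topologically nilpotent element,
uniformly in a dilation of the variables. -/
theorem exists_forall_pow_mul_eval_eq {σ : Type*} {a : unitBall F} (ha : ‖a‖ < 1)
    (P : MvPolynomial σ F) :
    ∃ m₀ : ℕ, ∀ m, m₀ ≤ m → ∀ e : unitBall F, ∃ P' : MvPolynomial σ (unitBall F),
      ∀ y : σ → unitBall F, (a : F) ^ m * MvPolynomial.eval (fun i => (e : F) * y i) P =
        (MvPolynomial.eval y P' : unitBall F) := by
  -- The dilation `e` is quantified after `m` because it will be a power of a whose exponent depends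
  -- on `m`.
  induction P using MvPolynomial.induction_on with
  | C c =>
    have hlim : Filter.Tendsto (fun m : ℕ => ‖a‖ ^ m * ‖c‖) Filter.atTop (𝓝 (0 * ‖c‖)) :=
      (tendsto_pow_atTop_nhds_zero_of_lt_one (norm_nonneg a) ha).mul_const _
    rw [zero_mul] at hlim
    obtain ⟨m₀, hm₀⟩ := Filter.eventually_atTop.1 (hlim.eventually_le_const zero_lt_one)
    refine ⟨m₀, fun m hm e => ⟨MvPolynomial.C ⟨(a : F) ^ m * c, ?_⟩, fun y => by simp⟩⟩
    rw [mem_unitBall, norm_mul, norm_pow]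
    exact hm₀ m hm
  | add P Q hP hQ =>
    obtain ⟨m₁, h₁⟩ := hP
    obtain ⟨m₂, h₂⟩ := hQ
    refine ⟨max m₁ m₂, fun m hm e => ?_⟩
    obtain ⟨P', hP'⟩ := h₁ m ((le_max_left _ _).trans hm) e
    obtain ⟨Q', hQ'⟩ := h₂ m ((le_max_right _ _).trans hm) e
    exact ⟨P' + Q', fun y => by simp [mul_add, hP', hQ']⟩
  | mul_X P i hP =>
    obtain ⟨m₀, h⟩ := hP
    refine ⟨m₀, fun m hm e => ?_⟩
    obtain ⟨P', hP'⟩ := h m hm e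
    exact ⟨P' * (MvPolynomial.C e * MvPolynomial.X i), fun y => by simp [← mul_assoc, hP']⟩

theorem exists_forall_forall_pow_mul_eval_eq {σ κ : Type*} [Finite κ] {a : unitBall F}
    (ha : ‖a‖ < 1) (P : κ → MvPolynomial σ F) :
    ∃ m₀ : ℕ, ∀ m, m₀ ≤ m → ∀ e : unitBall F, ∃ P' : κ → MvPolynomial σ (unitBall F),
      ∀ k, ∀ y : σ → unitBall F, (a : F) ^ m * MvPolynomial.eval (fun i => (e : F) * y i) (P k) =
        (MvPolynomial.eval y (P' k) : unitBall F) := by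
  choose m h using fun k => exists_forall_pow_mul_eval_eq ha (P k)
  obtain ⟨M, hM⟩ := (Set.finite_range m).bddAbove
  refine ⟨M, fun n hn e => ?_⟩
  choose P' hP' using fun k => h k n ((hM ⟨k, rfl⟩).trans hn) e
  exact ⟨P', hP'⟩

variable [CompleteSpace F]

/-- Let `f(y) = a y + Q(y) / S(y)` be a rational self-map of affine space, with `Q` of order at
least two at the origin and `S(0) ≠ 0`. Then the orbit of a point close to the origin is defined,
and a polynomial that vanishes at infinitely many points of the orbit vanishes on the orbit. -/
theorem exists_radius_forall_orbit {σ : Type*} [Fintype σ] {lam : F} (hlam0 : lam ≠ 0)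
    (hlam1 : ‖lam‖ < 1) (S : MvPolynomial σ F) (hS : MvPolynomial.constantCoeff S ≠ 0)
    (Q : σ → MvPolynomial σ F) (hQ : ∀ i, Q i ∈ MvPolynomial.idealOfVars σ F ^ 2) :
    ∃ r : ℝ, 0 < r ∧ ∀ x : σ → F, (∀ i, ‖x i‖ ≤ r) → ∃ g : ℕ → σ → F, g 0 = x ∧
      (∀ n, MvPolynomial.eval (g n) S ≠ 0 ∧ ∀ i,
        MvPolynomial.eval (g n) S * (g (n + 1) i - lam * g n i) = MvPolynomial.eval (g n) (Q i)) ∧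
      ∀ G : MvPolynomial σ F, {n | MvPolynomial.eval (g n) G = 0}.Infinite →
        ∀ n, MvPolynomial.eval (g n) G = 0 := by
  set s := MvPolynomial.constantCoeff S with hs
  obtain ⟨c, hc⟩ : ∃ c : σ → MvPolynomial σ F,
      S - MvPolynomial.C s = ∑ j, c j * MvPolynomial.X j := by
    apply exists_eq_sum_mul_X_of_mem_idealOfVars
    rw [← pow_one (MvPolynomial.idealOfVars σ F), MvPolynomial.mem_pow_idealOfVars_iff']
    intro x hx
    have : x = 0 := (Finsupp.degree_eq_zero_iff x).1 (by simpa using hx)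
    simp [this, hs, MvPolynomial.constantCoeff_eq]
  choose A hA using fun i => exists_eq_sum_mul_X_mul_X_of_mem_idealOfVars_sq (hQ i)
  let a : unitBall F := ⟨lam, hlam1.le⟩
  have ha : ‖a‖ < 1 := hlam1
  have ha0 : a ≠ 0 := fun h => hlam0 (congrArg Subtype.val h)
  obtain ⟨m₁, h₁⟩ := exists_forall_forall_pow_mul_eval_eq ha fun j => MvPolynomial.C s⁻¹ * c j
  obtain ⟨m₂, h₂⟩ := exists_forall_forall_pow_mul_eval_eq ha
    fun t : σ × σ × σ => MvPolynomial.C s⁻¹ * A t.1 t.2.1 t.2.2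
  set m := max m₁ m₂
  -- The terms of S − s carry a factor e and those of Q a factor e². One factor e = a^m a² is split:
  -- a^m clears denominators and a² survives. The second e in Q is the dilation of the target.
  let e : unitBall F := a ^ (m + 2)
  have he : (e : F) = lam ^ m * lam ^ 2 := pow_add lam m 2
  have he0 : (e : F) ≠ 0 := by rw [he]; positivity
  obtain ⟨c', hc'⟩ := h₁ m (le_max_left _ _) e
  obtain ⟨A', hA'⟩ := h₂ m (le_max_right _ _) e
  let S' : MvPolynomial σ (unitBall F) :=
    1 + MvPolynomial.C (a ^ 2) * ∑ j, c' j * MvPolynomial.X j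
  have hS'eval : ∀ y : σ → unitBall F, MvPolynomial.eval (fun i => (e : F) * y i) S =
      s * (MvPolynomial.eval y S' : unitBall F) := by
    intro y
    rw [eq_add_of_sub_eq hc]
    simp only [S', map_add, map_sum, map_mul, MvPolynomial.eval_C, MvPolynomial.eval_X, map_one,
      Subring.coe_add, Subring.coe_mul, Subring.coe_one, Subring.coe_pow,
      AddSubmonoidClass.coe_finsetSum, ← hc', mul_add, Finset.mul_sum]
    rw [add_comm, mul_one]
    congr 1
    refine Finset.sum_congr rfl fun j _ => ?_
    rw [he]
    field_simp
    simp only [a]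
    ring
  have hQeval : ∀ i, ∀ y : σ → unitBall F, MvPolynomial.eval (fun i => (e : F) * y i) (Q i) =
      s * e * (a ^ 2 * ∑ j, ∑ k, MvPolynomial.eval y (A' (i, j, k)) * (y j * y k) :
        unitBall F) := by
    intro i y
    rw [hA i]
    simp only [map_sum, map_mul, MvPolynomial.eval_C, MvPolynomial.eval_X, Subring.coe_mul,
      Subring.coe_pow, AddSubmonoidClass.coe_finsetSum, ← hA', Finset.mul_sum]
    refine Finset.sum_congr rfl fun j _ => Finset.sum_congr rfl fun k _ => ?_
    rw [he]
    field_simp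
    simp only [a]
    ring
  -- The curve starts at a times an integral point, whence the factor `lam` in the radius.
  refine ⟨‖(e : F) * lam‖, norm_pos_iff.2 (mul_ne_zero he0 hlam0), fun x hx => ?_⟩
  have hx' : ∀ i, x i / (e * lam) ∈ unitBall F := fun i => by
    rw [mem_unitBall, norm_div]
    exact div_le_one_of_le₀ (hx i) (norm_nonneg _)
  obtain ⟨γ, hγ0, hγ⟩ := exists_linearizing_curve ha S' (by simp [S'])
    (fun i j k => A' (i, j, k)) fun i => ⟨_, hx' i⟩
  have hz : ∀ n : ℕ, ‖a ^ (n + 1)‖ < 1 := fun n => by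
    rw [unitBall_norm_pow]
    exact pow_lt_one₀ (norm_nonneg _) ha n.succ_ne_zero
  -- Time 0 corresponds to z = a, since z = 1 is outside the open disc.
  let w : ℕ → σ → unitBall F := fun n i => evalDisc (a ^ (n + 1)) (hz n) (γ i)
  have hw : ∀ n P, evalDisc (a ^ (n + 1)) (hz n) (MvPolynomial.aeval γ P) =
      MvPolynomial.eval (w n) P := fun n P =>
    map_aeval_eq_eval (evalDisc _ (hz n)) (fun r => evalDisc_C _ _ r) γ P
  have hrec : ∀ n i, MvPolynomial.eval (w n) S' * (w (n + 1) i - a * w n i) =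
      a ^ 2 * ∑ j, ∑ k, MvPolynomial.eval (w n) (A' (i, j, k)) * (w n j * w n k) := by
    intro n i
    have := congrArg (evalDisc (a ^ (n + 1)) (hz n)) (hγ i)
    rw [map_mul, map_sub, evalDisc_rescale (hz n) (hz (n + 1)) (pow_succ' a (n + 1)), map_mul,
      evalDisc_C, map_mul, evalDisc_C, hw] at this
    simpa only [map_sum, map_mul, hw] using this
  refine ⟨fun n i => e * w n i, ?_, fun n => ⟨?_, fun i => ?_⟩, fun G hG n => ?_⟩
  · funext i
    have h0 : w 0 i = a * ⟨_, hx' i⟩ := by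
      rw [← hγ0 i]
      simp only [w, zero_add, pow_one]
    change (e : F) * w 0 i = x i
    rw [h0]
    simp only [Subring.coe_mul, a]
    field_simp
  · rw [hS'eval]
    -- S' is congruent to 1 modulo a, so it has no integral zeros.
    refine mul_ne_zero hS fun h0 => ?_
    have h0 : MvPolynomial.eval (w n) S' = 0 := Subtype.ext h0
    have h1 : a ∣ 1 := by
      simp only [S', map_add, map_one, map_mul, MvPolynomial.eval_C] at h0
      rw [eq_neg_of_add_eq_zero_left h0]
      exact ((dvd_pow_self a two_ne_zero).mul_right _).neg_right
    have := norm_le_of_unitBall_dvd h1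
    rw [norm_one] at this
    exact absurd this (not_le.2 ha)
  · rw [hS'eval, hQeval, ← hrec]
    simp only [Subring.coe_mul, AddSubgroupClass.coe_sub, a]
    ring
  · obtain ⟨k, hk⟩ := exists_forall_pow_mul_eval_eq ha G
    obtain ⟨G', hG'⟩ := hk k le_rfl e
    have hiff : ∀ n, MvPolynomial.eval (fun i => (e : F) * w n i) G = 0 ↔
        evalDisc (a ^ (n + 1)) (hz n) (MvPolynomial.aeval γ G') = 0 := by
      intro n
      rw [hw, ← Subring.coe_eq_zero_iff, ← hG', mul_eq_zero]
      simp [a, hlam0]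
    have hzero : MvPolynomial.aeval γ G' = 0 := by
      by_contra hne
      refine hG ?_
      simp only [hiff]
      refine finite_setOf_evalDisc_eq_zero hne (fun n => a ^ (n + 1)) hz
        (fun n => pow_ne_zero _ ha0) ?_
      exact (tendsto_pow_atTop_nhds_zero_of_norm_lt_one ha).comp (Filter.tendsto_add_atTop_nat 1)
    rw [hiff, hzero, map_zero]

end LocalDynamics

universe u

/-! ### Cotangent action, germs and affine coordinates at a rational point. -/

section Geometry

variable {K : Type u} [Field K] {X : SchOver K}

/-- If the differential of `f` at a fixed point `x` is a scalar `c`, then `f` acts as `c` on the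
cotangent space at `x`. -/
theorem pullback_sub_smul_mem_sq (f : X ⟶ X) {x : Pt X} (h : x ≫ f = x) {c : K}
    (hD : differential f h = c • LinearMap.id) {g : LocalRing x} (hg : value x g = 0) :
    pullback f h g - c • g ∈ RingHom.ker (value x) ^ 2 := by
  by_contra hne
  -- A linear functional that kills m² and the constants is a derivation at x. If g∘f − cg were
  -- outside m², it would also be outside m² + K, since it vanishes at x; a functional separating it
  -- would contradict `hD`.
  set N : Submodule K (LocalRing x) :=
    (RingHom.ker (value x) ^ 2).restrictScalars K ⊔ Submodule.span K {1} with hN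
  have hvalue : ∀ a : K, value x (a • (1 : LocalRing x)) = a := fun a => by
    rw [← Algebra.algebraMap_eq_smul_one, value_algebraMap]
  have hnot : pullback f h g - c • g ∉ N := by
    intro hmem
    obtain ⟨y, hy, z, hz, hyz⟩ := Submodule.mem_sup.1 hmem
    obtain ⟨a, rfl⟩ := Submodule.mem_span_singleton.1 hz
    have hy' : value x y = 0 := Ideal.pow_le_self two_ne_zero hy
    have h0 := congrArg (value x) hyz
    rw [map_add, hy', hvalue, map_sub, value_pullback, Algebra.smul_def, map_mul, hg, mul_zero,
      sub_zero, zero_add] at h0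
    rw [h0, zero_smul, add_zero] at hyz
    exact hne (hyz ▸ hy)
  obtain ⟨φ, hφ, hker⟩ := Submodule.exists_le_ker_of_notMem hnot
  have hφ1 : φ 1 = 0 :=
    hker (Submodule.mem_sup_right (Submodule.mem_span_singleton_self (1 : LocalRing x)))
  have hφ2 : ∀ y ∈ RingHom.ker (value x) ^ 2, φ y = 0 := fun y hy =>
    hker (Submodule.mem_sup_left hy)
  let D : TangentSpace x := Derivation.mk' φ fun a b => by
    have hsub : ∀ a, a - value x a • (1 : LocalRing x) ∈ RingHom.ker (value x) := fun a => by
      rw [RingHom.mem_ker, map_sub, hvalue, sub_self]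
    have h0 := hφ2 _ (pow_two (RingHom.ker (value x)) ▸ Ideal.mul_mem_mul (hsub a) (hsub b))
    have e : (a - value x a • (1 : LocalRing x)) * (b - value x b • (1 : LocalRing x)) =
        a * b - value x a • b - value x b • a + (value x a * value x b) • (1 : LocalRing x) := by
      simp only [Algebra.smul_def, map_mul]
      ring
    rw [e] at h0
    simp only [map_add, map_sub, map_smul, hφ1, smul_eq_mul] at h0
    rw [smul_eq_value_mul, smul_eq_value_mul]
    linear_combination h0
  have hDg : φ (pullback f h g) = c * φ g :=
    DFunLike.congr_fun (LinearMap.congr_fun hD D) g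
  apply hφ
  rw [map_sub, map_smul, hDg, smul_eq_mul, sub_self]

/-- The value at `x ∈ U(K)` of a regular function on `U`. -/
def evalAt (U : X.left.Opens) (x : Pt X) (hx : x.pt ∈ U) : Γ(X.left, U) →+* K :=
  (value x).comp (germ x U hx)

theorem isUnit_iff_value_ne_zero {x : Pt X} {g : LocalRing x} : IsUnit g ↔ value x g ≠ 0 := by
  rw [← isUnit_iff_ne_zero]
  refine ⟨fun h => h.map _, fun h => ?_⟩
  have : IsLocalHom (Scheme.stalkClosedPointTo x.left).hom := inferInstance
  exact this.map_nonunit g h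

theorem mem_basicOpen_iff_evalAt_ne_zero {U : X.left.Opens} {x : Pt X} (hx : x.pt ∈ U)
    (a : Γ(X.left, U)) : x.pt ∈ X.left.basicOpen a ↔ evalAt U x hx a ≠ 0 :=
  (X.left.mem_basicOpen a x.pt hx).trans isUnit_iff_value_ne_zero

theorem germ_restrict {U V : X.left.Opens} (h : V ≤ U) {x : Pt X} (hx : x.pt ∈ V)
    (a : Γ(X.left, U)) :
    germ x V hx (X.left.presheaf.map (homOfLE h).op a) = germ x U (h hx) a :=
  X.left.presheaf.germ_res_apply (homOfLE h) x.pt hx a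

theorem exists_germ_eq_zero {V : X.left.Opens} {x : Pt X} (hx : x.pt ∈ V) (a : Γ(X.left, V))
    (ha : germ x V hx a = 0) : ∃ W : X.left.Opens, ∃ hW : W ≤ V, x.pt ∈ W ∧
      ∀ (y : Pt X) (hy : y.pt ∈ W), germ y V (hW hy) a = 0 := by
  obtain ⟨W, hxW, i₁, i₂, h⟩ := X.left.presheaf.germ_eq x.pt hx hx a 0
    (ha.trans (map_zero (germ x V hx)).symm)
  refine ⟨W, i₁.le, hxW, fun y hy => ?_⟩
  rw [← germ_restrict i₁.le hy]
  refine (congrArg (germ y W hy) h).trans ?_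
  rw [map_zero, map_zero]

/-- Germs in the square of the maximal ideal, written as fractions of regular functions on an
affine neighbourhood. -/
theorem exists_germ_mul_eq_germ {U : X.left.Opens} (hU : IsAffineOpen U) {x : Pt X}
    (hx : x.pt ∈ U) {g : LocalRing x} (hg : g ∈ RingHom.ker (value x) ^ 2) :
    ∃ s q : Γ(X.left, U), evalAt U x hx s ≠ 0 ∧ q ∈ RingHom.ker (evalAt U x hx) ^ 2 ∧
      germ x U hx s * g = germ x U hx q := by
  let : Algebra Γ(X.left, U) (LocalRing x) := (germ x U hx).toAlgebra
  let P := (hU.primeIdealOf ⟨x.pt, hx⟩).asIdeal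
  have hloc : IsLocalization P.primeCompl (LocalRing x) := hU.isLocalization_stalk ⟨x.pt, hx⟩
  have hunit : ∀ s : P.primeCompl, evalAt U x hx s ≠ 0 := fun s =>
    isUnit_iff_value_ne_zero.1 (IsLocalization.map_units (LocalRing x) s)
  -- The maximal ideal of the stalk is extended from U, and extension commutes with squares.
  have hle : RingHom.ker (value x) ≤
      (RingHom.ker (evalAt U x hx)).map (algebraMap Γ(X.left, U) (LocalRing x)) := by
    intro y hy
    obtain ⟨⟨a, s⟩, has⟩ := IsLocalization.surj P.primeCompl y
    refine (IsLocalization.mem_map_algebraMap_iff P.primeCompl _).2 ⟨⟨⟨a, ?_⟩, s⟩, has⟩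
    have := congrArg (value x) has
    rw [map_mul, (RingHom.mem_ker.1 hy), zero_mul] at this
    exact this.symm
  have hmem := Ideal.pow_right_mono hle 2 hg
  rw [← Ideal.map_pow, IsLocalization.mem_map_algebraMap_iff P.primeCompl] at hmem
  obtain ⟨⟨q, s⟩, h⟩ := hmem
  exact ⟨s, q, hunit s, q.2, (mul_comm _ _).trans h⟩

/-- Scalars as regular functions on an open subset. -/
def scalarOn (U : X.left.Opens) : K →+* Γ(X.left, U) :=
  (X.left.presheaf.map (homOfLE (le_top : U ≤ ⊤)).op).hom.comp (scalar X)

theorem germ_scalarOn {U : X.left.Opens} {x : Pt X} (hx : x.pt ∈ U) (c : K) :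
    germ x U hx (scalarOn U c) = algebraMap K (LocalRing x) c :=
  germ_restrict le_top hx (scalar X c)

theorem evalAt_scalarOn {U : X.left.Opens} {x : Pt X} (hx : x.pt ∈ U) (c : K) :
    evalAt U x hx (scalarOn U c) = c := by
  rw [evalAt, RingHom.comp_apply, germ_scalarOn, value_algebraMap]

theorem finiteType_scalarOn [LocallyOfFiniteType X.hom] {U : X.left.Opens} (hU : IsAffineOpen U) :
    (scalarOn U).FiniteType := by
  have h := LocallyOfFiniteType.finiteType_appLE X.hom (isAffineOpen_top _) hU le_top
  have e : scalarOn U = (X.hom.appLE ⊤ U le_top).hom.comp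
      (Scheme.ΓSpecIso (CommRingCat.of K)).inv.hom := rfl
  rw [e]
  refine h.comp (RingHom.FiniteType.of_surjective _ ?_)
  exact (Scheme.ΓSpecIso (CommRingCat.of K)).symm.commRingCatIsoToRingEquiv.surjective

-- The degree-zero part consists of constants, so Proj is of finite type over K itself.
attribute [local instance] MvPolynomial.gradedAlgebra in
theorem locallyOfFiniteType_projectiveSpace (n : ℕ) :
    LocallyOfFiniteType (projectiveSpace K n).hom := by
  have : IsScalarTower K (MvPolynomial.homogeneousSubmodule (Fin (n + 1)) K 0)
      (MvPolynomial (Fin (n + 1)) K) := 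
    ⟨fun a b c => smul_mul_assoc a (b : MvPolynomial (Fin (n + 1)) K) c⟩
  have hfin : Algebra.FiniteType (MvPolynomial.homogeneousSubmodule (Fin (n + 1)) K 0)
      (MvPolynomial (Fin (n + 1)) K) :=
    Algebra.FiniteType.of_restrictScalars_finiteType K _ _
  have hsurj : Function.Surjective
      (algebraMap K (MvPolynomial.homogeneousSubmodule (Fin (n + 1)) K 0)) := by
    rintro ⟨P, hP⟩
    refine ⟨P.coeff 0, Subtype.ext ?_⟩
    rw [MvPolynomial.mem_homogeneousSubmodule] at hP
    exact (MvPolynomial.totalDegree_eq_zero_iff_eq_C.1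
      ((MvPolynomial.totalDegree_zero_iff_isHomogeneous (p := P)).2 hP)).symm
  have h1 : LocallyOfFiniteType
      (Proj.toSpecZero (MvPolynomial.homogeneousSubmodule (Fin (n + 1)) K)) := inferInstance
  have h2 : LocallyOfFiniteType (Spec.map (CommRingCat.ofHom
      (algebraMap K (MvPolynomial.homogeneousSubmodule (Fin (n + 1)) K 0)))) := by
    rw [HasRingHomProperty.Spec_iff (P := @LocallyOfFiniteType)]
    exact RingHom.FiniteType.of_surjective _ hsurj
  exact @locallyOfFiniteType_comp _ _ _ _ _ h1 h2

theorem IsQuasiProjective.locallyOfFiniteType (hX : IsQuasiProjective X) :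
    LocallyOfFiniteType X.hom := by
  obtain ⟨n, i, hi⟩ := hX
  have := locallyOfFiniteType_projectiveSpace (K := K) n
  rw [← Over.w i]
  infer_instance

/-- An affine neighbourhood of a rational point is a closed subscheme of an affine space, with the
point at the origin. -/
theorem exists_surjective_coordinates [LocallyOfFiniteType X.hom] {U : X.left.Opens}
    (hU : IsAffineOpen U) {x : Pt X} (hx : x.pt ∈ U) :
    ∃ (n : ℕ) (y : Fin n → Γ(X.left, U)), (∀ i, evalAt U x hx (y i) = 0) ∧
      Function.Surjective (MvPolynomial.eval₂Hom (scalarOn U) y) := by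
  let := (scalarOn U).toAlgebra
  have : Algebra.FiniteType K Γ(X.left, U) := finiteType_scalarOn hU
  obtain ⟨n, ρ, hρ⟩ := Algebra.FiniteType.iff_quotient_mvPolynomial''.1 this
  -- Generators are shifted by their values, which moves the point to the origin.
  let z : Fin n → K := fun i => evalAt U x hx (ρ (MvPolynomial.X i))
  refine ⟨n, fun i => ρ (MvPolynomial.X i) - scalarOn U (z i), fun i => ?_, fun a => ?_⟩
  · rw [map_sub, evalAt_scalarOn, sub_self]
  · obtain ⟨P, rfl⟩ := hρ a
    refine ⟨MvPolynomial.aeval (fun i => MvPolynomial.X i + MvPolynomial.C (z i)) P, ?_⟩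
    induction P using MvPolynomial.induction_on with
    | C c =>
      rw [MvPolynomial.algHom_C, MvPolynomial.algHom_C]
      exact MvPolynomial.eval₂Hom_C _ _ c
    | add P Q hP hQ => simp only [map_add, hP, hQ]
    | mul_X P i hP =>
      rw [map_mul, map_mul, hP, map_mul, MvPolynomial.aeval_X, map_add, MvPolynomial.eval₂Hom_X',
        MvPolynomial.eval₂Hom_C, sub_add_cancel]

theorem evalAt_eval₂Hom {U : X.left.Opens} {σ : Type*} (y : σ → Γ(X.left, U)) {x : Pt X}
    (hx : x.pt ∈ U) (P : MvPolynomial σ K) :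
    evalAt U x hx (MvPolynomial.eval₂Hom (scalarOn U) y P) =
      MvPolynomial.eval (fun i => evalAt U x hx (y i)) P := by
  have : (evalAt U x hx).comp (scalarOn U) = RingHom.id K := RingHom.ext (evalAt_scalarOn hx)
  rw [MvPolynomial.coe_eval₂Hom, MvPolynomial.hom_eval₂, this]
  rfl

/-- As the coordinates vanish at x, the ideal of x is the image of the ideal of the variables, and
likewise for squares. -/
theorem exists_mem_idealOfVars_sq {U : X.left.Opens} {σ : Type*} {y : σ → Γ(X.left, U)} {x : Pt X}
    {hx : x.pt ∈ U} (hy : ∀ i, evalAt U x hx (y i) = 0)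
    (hsurj : Function.Surjective (MvPolynomial.eval₂Hom (scalarOn U) y)) {q : Γ(X.left, U)}
    (hq : q ∈ RingHom.ker (evalAt U x hx) ^ 2) :
    ∃ Q ∈ MvPolynomial.idealOfVars σ K ^ 2, MvPolynomial.eval₂Hom (scalarOn U) y Q = q := by
  rw [← Ideal.mem_map_iff_of_surjective _ hsurj, Ideal.map_pow]
  refine Ideal.pow_right_mono ?_ 2 hq
  intro a ha
  obtain ⟨P, rfl⟩ := hsurj a
  refine Ideal.mem_map_of_mem _ ?_
  rw [RingHom.mem_ker, evalAt_eval₂Hom, funext hy] at ha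
  rw [← pow_one (MvPolynomial.idealOfVars σ K), MvPolynomial.mem_pow_idealOfVars_iff']
  intro d hd
  have : d = 0 := (Finsupp.degree_eq_zero_iff d).1 (by simpa using hd)
  rw [this, ← MvPolynomial.constantCoeff_eq, ← MvPolynomial.eval_zero]
  exact ha

end Geometry

/-! ### The return map as a rational map in coordinates. -/

section Model

variable {K : Type u} [Field K] {X : SchOver K}

theorem iter_zero (f : X ⟶ X) : iter f 0 = 𝟙 X := rfl

theorem iter_succ (f : X ⟶ X) (n : ℕ) : iter f (n + 1) = iter f n ≫ f := rfl

theorem iter_add (f : X ⟶ X) (m n : ℕ) : iter f (m + n) = iter f m ≫ iter f n := by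
  induction n with
  | zero => simp [iter_zero]
  | succ n ih => rw [← Nat.add_assoc, iter_succ, iter_succ, ih, Category.assoc]

theorem iter_mul (f : X ⟶ X) (m n : ℕ) : iter f (m * n) = iter (iter f m) n := by
  induction n with
  | zero => rfl
  | succ n ih => rw [Nat.mul_succ, iter_add, iter_succ, ih]

theorem evalAt_comp (f : X ⟶ X) {U : X.left.Opens} (x : Pt X) (hx : Pt.pt (x ≫ f) ∈ U)
    (a : Γ(X.left, U)) :
    value x (germ x (f.left ⁻¹ᵁ U) hx (f.left.app U a)) = evalAt U (x ≫ f) hx a := by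
  rw [← pullback_germ f rfl U hx hx a, value_pullback]
  rfl

/-- If `f` fixes `x` and its differential there is a scalar `c`, then a regular function `a` near
`x` that vanishes at `x` satisfies `a ∘ f = c a + q / s` near `x`, with `q` in the square of the
ideal of `x` and `s(x) ≠ 0`. -/
theorem exists_evalAt_comp_eq (f : X ⟶ X) {x : Pt X} (h : x ≫ f = x) {c : K}
    (hD : differential f h = c • LinearMap.id) {U : X.left.Opens} (hU : IsAffineOpen U)
    (hx : x.pt ∈ U) {a : Γ(X.left, U)} (ha : evalAt U x hx a = 0) :
    ∃ s q : Γ(X.left, U), evalAt U x hx s ≠ 0 ∧ q ∈ RingHom.ker (evalAt U x hx) ^ 2 ∧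
      ∀ (y : Pt X) (hy : y.pt ∈ U), evalAt U y hy s ≠ 0 → ∃ hfy : Pt.pt (y ≫ f) ∈ U,
        evalAt U y hy s * (evalAt U (y ≫ f) hfy a - c * evalAt U y hy a) = evalAt U y hy q := by
  obtain ⟨s, q, hs, hq, hsq⟩ := exists_germ_mul_eq_germ hU hx (pullback_sub_smul_mem_sq f h hD ha)
  have hfx : x.pt ∈ f.left ⁻¹ᵁ U := by
    change Pt.pt (x ≫ f) ∈ U
    rwa [h]
  let V : X.left.Opens := U ⊓ f.left ⁻¹ᵁ U
  have hVU : V ≤ U := inf_le_left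
  have hVf : V ≤ f.left ⁻¹ᵁ U := inf_le_right
  have hxV : x.pt ∈ V := ⟨hx, hfx⟩
  -- The defect of the desired identity, whose germ at x is zero.
  let e : Γ(X.left, V) :=
    X.left.presheaf.map (homOfLE hVU).op s *
      (X.left.presheaf.map (homOfLE hVf).op (f.left.app U a) -
        X.left.presheaf.map (homOfLE hVU).op (scalarOn U c * a)) -
    X.left.presheaf.map (homOfLE hVU).op q
  have he : ∀ (y : Pt X) (hy : y.pt ∈ V), germ y V hy e =
      germ y U (hVU hy) s * (germ y (f.left ⁻¹ᵁ U) (hVf hy) (f.left.app U a) -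
        c • germ y U (hVU hy) a) - germ y U (hVU hy) q := by
    intro y hy
    simp only [e]
    rw [map_sub, map_mul, map_sub, germ_restrict hVU, germ_restrict hVU, germ_restrict hVU,
      germ_restrict hVf, map_mul, germ_scalarOn, Algebra.smul_def]
  obtain ⟨W, hWV, hxW, hW⟩ := exists_germ_eq_zero hxV e (by
    rw [he, ← pullback_germ f h U hx hfx a, hsq, sub_self])
  obtain ⟨t, htW, hxt⟩ := hU.exists_basicOpen_le ⟨x.pt, hxW⟩ hx
  rw [mem_basicOpen_iff_evalAt_ne_zero hx] at hxt
  -- Since D(t) ⊆ W, a nonzero denominator now forces the point into W.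
  refine ⟨t * s, t * q, ?_, Ideal.mul_mem_left _ _ hq, fun y hy hne => ?_⟩
  · rw [map_mul]
    exact mul_ne_zero hxt hs
  · rw [map_mul] at hne
    have hyW : y.pt ∈ W :=
      htW ((mem_basicOpen_iff_evalAt_ne_zero hy t).2 (left_ne_zero_of_mul hne))
    have hyf : Pt.pt (y ≫ f) ∈ U := hVf (hWV hyW)
    refine ⟨hyf, ?_⟩
    have h0 := congrArg (value y) ((he y (hWV hyW)).symm.trans (hW y hyW))
    rw [map_zero, map_sub, map_mul, map_sub, evalAt_comp f y hyf, Algebra.smul_def, map_mul,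
      value_algebraMap] at h0
    change evalAt U y hy s * (evalAt U (y ≫ f) hyf a - c * evalAt U y hy a) - evalAt U y hy q = 0
      at h0
    rw [map_mul, map_mul, ← sub_eq_zero]
    linear_combination evalAt U y hy t * h0

/-- A self-map with scalar differential `c` at a fixed point `x` is, in affine coordinates centred
at `x`, of the form `y ↦ c y + Q(y) / S(y)` with `Q` of order at least two and `S(0) ≠ 0`. -/
theorem exists_rational_model [LocallyOfFiniteType X.hom] (f : X ⟶ X) {x : Pt X} (h : x ≫ f = x)
    {c : K} (hD : differential f h = c • LinearMap.id) {U : X.left.Opens} (hU : IsAffineOpen U)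
    (hx : x.pt ∈ U) :
    ∃ (n : ℕ) (y : Fin n → Γ(X.left, U)) (S : MvPolynomial (Fin n) K)
      (Q : Fin n → MvPolynomial (Fin n) K), (∀ i, evalAt U x hx (y i) = 0) ∧
      Function.Surjective (MvPolynomial.eval₂Hom (scalarOn U) y) ∧
      MvPolynomial.constantCoeff S ≠ 0 ∧ (∀ i, Q i ∈ MvPolynomial.idealOfVars (Fin n) K ^ 2) ∧
      ∀ (z : Pt X) (hz : z.pt ∈ U),
        MvPolynomial.eval (fun i => evalAt U z hz (y i)) S ≠ 0 → ∃ hfz : Pt.pt (z ≫ f) ∈ U, ∀ i,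
          MvPolynomial.eval (fun i => evalAt U z hz (y i)) S *
            (evalAt U (z ≫ f) hfz (y i) - c * evalAt U z hz (y i)) =
          MvPolynomial.eval (fun i => evalAt U z hz (y i)) (Q i) := by
  obtain ⟨n, y, hy, hsurj⟩ := exists_surjective_coordinates hU hx
  choose s q hs hq hsq using fun i => exists_evalAt_comp_eq f h hD hU hx (hy i)
  -- The zero function supplies a denominator ensuring f(z) ∈ U even when there are no coordinates.
  obtain ⟨s₀, q₀, hs₀, -, hsq₀⟩ := exists_evalAt_comp_eq f h hD hU hx (map_zero (evalAt U x hx))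
  obtain ⟨S, hS⟩ := hsurj (s₀ * ∏ i, s i)
  have hdvd : ∀ i, s i ∣ s₀ * ∏ i, s i := fun i =>
    (Finset.dvd_prod_of_mem s (Finset.mem_univ i)).mul_left s₀
  choose r hr using hdvd
  choose Q hQ hQr using fun i =>
    exists_mem_idealOfVars_sq hy hsurj (Ideal.mul_mem_left _ (r i) (hq i))
  have hSeval : ∀ (z : Pt X) (hz : z.pt ∈ U),
      MvPolynomial.eval (fun i => evalAt U z hz (y i)) S = evalAt U z hz (s₀ * ∏ i, s i) :=
    fun z hz => by rw [← hS, evalAt_eval₂Hom]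
  refine ⟨n, y, S, Q, hy, hsurj, ?_, hQ, fun z hz hne => ?_⟩
  · have := hSeval x hx
    rw [funext hy] at this
    rw [← MvPolynomial.eval_zero]
    refine this.trans_ne ?_
    rw [map_mul, map_prod]
    exact mul_ne_zero hs₀ (Finset.prod_ne_zero_iff.2 fun i _ => hs i)
  · rw [hSeval] at hne
    have hne₀ := hne
    rw [map_mul] at hne₀
    obtain ⟨hfz, _⟩ := hsq₀ z hz (left_ne_zero_of_mul hne₀)
    refine ⟨hfz, fun i => ?_⟩
    have hi := hr i ▸ hne
    rw [map_mul] at hi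
    obtain ⟨_, e⟩ := hsq i z hz (left_ne_zero_of_mul hi)
    rw [hSeval, hr i, ← evalAt_eval₂Hom y hz (Q i), hQr, map_mul, map_mul, ← e]
    ring

theorem mem_closedPts_comp (g : X ⟶ X) (x : Pt X) (V : TopologicalSpace.Closeds X.left) :
    x ≫ g ∈ closedPts V ↔ x ∈ closedPts (V.preimage g.left.continuous) := Iff.rfl

end Model

/-! ### Entering the polydisc and the finite-or-always dichotomy. -/

section Orbits

variable {K : Type u} [NormedField K] {X : SchOver K}

/-- A small polydisc around `x` is a neighbourhood of `x`. -/
theorem exists_mem_orbit_of_mem_closure {f : X ⟶ X} {x b : Pt X}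
    (hb : b ∈ closure[pointTopology X] (orbit f x)) {U : X.left.Opens} (hbU : b.pt ∈ U) {n : ℕ}
    {y : Fin n → Γ(X.left, U)} (hy : ∀ i, evalAt U b hbU (y i) = 0) {r : ℝ} (hr : 0 < r) :
    ∃ (l : ℕ) (hl : Pt.pt (x ≫ iter f l) ∈ U), ∀ i, ‖evalAt U (x ≫ iter f l) hl (y i)‖ ≤ r := by
  let _ := pointTopology X
  have hopen : ∀ (a : Γ(X.left, U)) (W : Set K), IsOpen W →
      IsOpen {z : Pt X | ∃ hz : z.pt ∈ U, evalAt U z hz a ∈ W} := fun a W hW =>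
    TopologicalSpace.isOpen_generateFrom_of_mem ⟨U, a, W, hW, rfl⟩
  -- The first set is U(K) itself, needed when n = 0.
  have hN : IsOpen ({z : Pt X | ∃ hz : z.pt ∈ U, evalAt U z hz 0 ∈ Set.univ} ∩
      ⋂ i, {z : Pt X | ∃ hz : z.pt ∈ U, evalAt U z hz (y i) ∈ Metric.ball 0 r}) :=
    (hopen _ _ isOpen_univ).inter (isOpen_iInter_of_finite fun i => hopen _ _ Metric.isOpen_ball)
  obtain ⟨z, ⟨⟨hz, -⟩, hzr⟩, l, rfl⟩ := mem_closure_iff.1 hb _ hN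
    ⟨⟨hbU, trivial⟩, Set.mem_iInter.2 fun i => ⟨hbU, by simpa [hy i] using hr⟩⟩
  refine ⟨l, hz, fun i => ?_⟩
  obtain ⟨_, hi⟩ := Set.mem_iInter.1 hzr i
  exact (mem_ball_zero_iff.1 hi).le

/-- Near a fixed point at which the differential is a contracting nonzero scalar, an orbit meets
a closed subset in finitely many points of time or always. -/
theorem exists_iter_forall_closed_finite_or_forall [IsUltrametricDist K] [CompleteSpace K]
    [LocallyOfFiniteType X.hom] (f : X ⟶ X) {b : Pt X} (h : b ≫ f = b) {c : K} (hc0 : c ≠ 0)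
    (hc1 : ‖c‖ < 1) (hD : differential f h = c • LinearMap.id) (g : X ⟶ X) {x : Pt X}
    (hb : b ∈ closure[pointTopology X] (orbit g x)) :
    ∃ l : ℕ, ∀ V : TopologicalSpace.Closeds X.left,
      {n | x ≫ iter g l ≫ iter f n ∈ closedPts V}.Finite ∨
        ∀ n, x ≫ iter g l ≫ iter f n ∈ closedPts V := by
  obtain ⟨U, hU, hbU, -⟩ := exists_isAffineOpen_mem_and_subset (U := ⊤) (x := b.pt) trivial
  obtain ⟨d, y, S, Q, hy, hsurj, hS, hQ, hmodel⟩ := exists_rational_model f h hD hU hbU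
  obtain ⟨r, hr, hlocal⟩ := exists_radius_forall_orbit hc0 hc1 S hS Q hQ
  obtain ⟨l, hl, hlr⟩ := exists_mem_orbit_of_mem_closure hb hbU hy hr
  obtain ⟨u, hu0, hu, hzero⟩ := hlocal _ hlr
  let z : ℕ → Pt X := fun n => x ≫ iter g l ≫ iter f n
  have hzsucc : ∀ n, z (n + 1) = z n ≫ f := fun n => by
    simp only [z, iter_succ, Category.assoc]
  have hz : ∀ n, ∃ hn : (z n).pt ∈ U, (fun i => evalAt U (z n) hn (y i)) = u n := by
    intro n
    induction n with
    | zero =>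
      have e : z 0 = x ≫ iter g l := by simp only [z, iter_zero, Category.comp_id]
      rw [e]
      exact ⟨hl, hu0.symm⟩
    | succ n ih =>
      obtain ⟨hn, e⟩ := ih
      obtain ⟨hne, hrec⟩ := hu n
      rw [← e] at hne
      obtain ⟨hfn, hrec'⟩ := hmodel (z n) hn hne
      rw [hzsucc]
      refine ⟨hfn, funext fun i => ?_⟩
      have h1 := (hrec' i).trans ((congrArg (fun v => MvPolynomial.eval v (Q i)) e).trans
        (hrec i).symm)
      rw [← e] at h1
      simpa using mul_left_cancel₀ hne h1
  choose hzU hzu using hz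
  have heval : ∀ n P, evalAt U (z n) (hzU n) (MvPolynomial.eval₂Hom (scalarOn U) y P) =
      MvPolynomial.eval (u n) P := fun n P => by rw [evalAt_eval₂Hom, hzu]
  -- One `l` serves every closed subset; this is what allows passing to preimages of V under Φ^j.
  refine ⟨l, fun V => or_iff_not_imp_left.2 fun hinf m => ?_⟩
  by_contra hm
  -- If z_m were outside V, some regular function t on U would vanish on V ∩ U but not at z_m; its
  -- polynomial lift contradicts `hzero`.
  obtain ⟨t, htV, hmt⟩ := hU.exists_basicOpen_le
    (V := ⟨(V : Set X.left)ᶜ, V.isClosed.isOpen_compl⟩) ⟨(z m).pt, hm⟩ (hzU m)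
  rw [mem_basicOpen_iff_evalAt_ne_zero (hzU m)] at hmt
  obtain ⟨G, rfl⟩ := hsurj t
  rw [heval] at hmt
  refine hmt (hzero G (Set.Infinite.mono (fun n hn => ?_) hinf) m)
  by_contra hne
  change ¬ MvPolynomial.eval (u n) G = 0 at hne
  rw [← heval] at hne
  exact htV ((mem_basicOpen_iff_evalAt_ne_zero (hzU n) _).2 hne) hn

end Orbits

/-! ### Assembling the residue classes modulo M. -/

/-- A set of natural numbers that, from `l` on, is finite or full in each residue class modulo `M`
is a finite union of arithmetic progressions. -/
theorem exists_finset_arithmetic_progressions {N : Set ℕ} {M l : ℕ} (hM : 0 < M)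
    (h : ∀ j, {n | l + (M * n + j) ∈ N}.Finite ∨ ∀ n, l + (M * n + j) ∈ N) :
    ∃ S : Finset (ℕ × ℕ), N = ⋃ kl ∈ S, Set.range fun n => kl.2 + kl.1 * n := by
  classical
  -- `J` gives the progressions of step M; the finitely many exceptions `E` become progressions of
  -- step 0.
  let J : Set ℕ := {j | j < M ∧ ∀ n, l + (M * n + j) ∈ N}
  let E : Set ℕ := N ∩ {m | m < l ∨ ∃ j < M, j ∉ J ∧ ∃ n, m = l + (M * n + j)}
  have hJ : J.Finite := (Set.finite_lt_nat M).subset fun j hj => hj.1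
  have hE : E.Finite := by
    have hfin : ((⋃ j ∈ {j | j < M ∧ j ∉ J},
        (fun n => l + (M * n + j)) '' {n | l + (M * n + j) ∈ N}) ∪ {m | m < l}).Finite := by
      refine Set.Finite.union (Set.Finite.biUnion ((Set.finite_lt_nat M).subset fun j hj => hj.1)
        fun j hj => Set.Finite.image _ ((h j).resolve_right fun hall => hj.2 ⟨hj.1, hall⟩))
        (Set.finite_lt_nat l)
    refine hfin.subset ?_
    rintro m ⟨hmN, hm | ⟨j, hj, hjJ, n, rfl⟩⟩
    · exact Or.inr hm
    · exact Or.inl (Set.mem_biUnion (show j ∈ {j | j < M ∧ j ∉ J} from ⟨hj, hjJ⟩) ⟨n, hmN, rfl⟩)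
  refine ⟨hE.toFinset.image (fun m => (0, m)) ∪ hJ.toFinset.image fun j => (M, l + j), ?_⟩
  ext m
  simp only [Set.mem_iUnion, Finset.mem_union, Finset.mem_image, Set.Finite.mem_toFinset,
    Set.mem_range, exists_prop]
  constructor
  · intro hm
    rcases lt_or_ge m l with hml | hml
    · exact ⟨(0, m), Or.inl ⟨m, ⟨hm, Or.inl hml⟩, rfl⟩, 0, by simp⟩
    · have hdiv : m = l + (M * ((m - l) / M) + (m - l) % M) := by
        rw [Nat.div_add_mod]
        omega
      by_cases hj : (m - l) % M ∈ J
      · exact ⟨(M, l + (m - l) % M), Or.inr ⟨_, hj, rfl⟩, (m - l) / M, by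
          dsimp only
          omega⟩
      · exact ⟨(0, m), Or.inl ⟨m, ⟨hm, Or.inr ⟨_, Nat.mod_lt _ hM, hj, _, hdiv⟩⟩, rfl⟩, 0, by simp⟩
  · rintro ⟨kl, ⟨e, he, rfl⟩ | ⟨j, hj, rfl⟩, n, rfl⟩
    · simpa using he.1
    · have := hj.2 n
      convert this using 1
      dsimp only
      ring

/-- The dynamical Mordell-Lang property of an orbit that accumulates at a periodic point at which
the differential of the return map is a contracting nonzero scalar. -/
theorem exists_closedPts_inter_orbit_eq {K : Type u} [NormedField K] [IsUltrametricDist K]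
    [CompleteSpace K] {X : SchOver K} (hX : IsQuasiProjective X) (Φ : X ⟶ X) (α : Pt X)
    (V : TopologicalSpace.Closeds X.left) {β : Pt X}
    (hβα : β ∈ closure[pointTopology X] (orbit Φ α)) {M : ℕ} (hM : 0 < M)
    (hβ : β ≫ iter Φ M = β) {lam : K} (hlam0 : lam ≠ 0) (hlam1 : ‖lam‖ < 1)
    (hD : differential (iter Φ M) hβ = lam • LinearMap.id) :
    ∃ S : Finset (ℕ × ℕ), closedPts V ∩ orbit Φ α =
      ⋃ kl ∈ S, orbit (iter Φ kl.1) (α ≫ iter Φ kl.2) := by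
  have := hX.locallyOfFiniteType
  obtain ⟨l, hl⟩ := exists_iter_forall_closed_finite_or_forall (iter Φ M) hβ hlam0
    hlam1 hD Φ hβα
  let N : Set ℕ := {n | α ≫ iter Φ n ∈ closedPts V}
  obtain ⟨S, hS⟩ := exists_finset_arithmetic_progressions (N := N) (l := l) hM fun j => by
    -- The class of j is the return-time problem of f = Φ^M for the preimage of V under Φ^j.
    have hmem : ∀ n, l + (M * n + j) ∈ N ↔ α ≫ iter Φ l ≫ iter (iter Φ M) n ∈
        closedPts (V.preimage (iter Φ j).left.continuous) := fun n => by
      rw [← mem_closedPts_comp, Category.assoc, Category.assoc, ← iter_mul, ← iter_add, ← iter_add]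
      exact Iff.rfl
    simpa only [hmem] using hl (V.preimage (iter Φ j).left.continuous)
  refine ⟨S, ?_⟩
  have horbit : ∀ kl : ℕ × ℕ, orbit (iter Φ kl.1) (α ≫ iter Φ kl.2) =
      (fun n => α ≫ iter Φ n) '' Set.range fun n => kl.2 + kl.1 * n := fun kl => by
    rw [← Set.range_comp]
    refine congrArg Set.range (funext fun n => ?_)
    rw [Function.comp_apply, iter_add, iter_mul, Category.assoc]
  simp only [horbit, ← Set.image_iUnion]
  rw [← hS]
  ext x
  constructor
  · rintro ⟨hx, n, rfl⟩
    exact ⟨n, hx, rfl⟩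
  · rintro ⟨n, hn, rfl⟩
    exact ⟨hn, n, rfl⟩

end DynML

end

theorem theorem1p2 (p : ℕ) [Fact p.Prime]
    (X : DynML.SchOver ℂ_[p]) (hX : DynML.IsQuasiProjective X)
    (Φ : X ⟶ X) (α : DynML.Pt X) (V : TopologicalSpace.Closeds X.left)
    (β : DynML.Pt X)
    (hβα : β ∈ closure[DynML.pointTopology X] (DynML.orbit Φ α))
    (M : ℕ) (hM : 0 < M) (hβ : β ≫ DynML.iter Φ M = β)
    (hns : ∀ j : ℕ, DynML.IsNonsingular (β ≫ DynML.iter Φ j))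
    (lam : ℂ_[p]) (hlam0 : lam ≠ 0) (hlam1 : ‖lam‖ < 1)
    (hD : DynML.differential (DynML.iter Φ M) hβ = lam • LinearMap.id) :
    ∃ S : Finset (ℕ × ℕ),
      DynML.closedPts V ∩ DynML.orbit Φ α =
        ⋃ kl ∈ S, DynML.orbit (DynML.iter Φ kl.1) (α ≫ DynML.iter Φ kl.2) := by
  -- Nonsingularity is not needed: the differential determines the action on the cotangent space.
  exact DynML.exists_closedPts_inter_orbit_eq hX Φ α V hβα hM hβ hlam0 hlam1 hD
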